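/- Let $S$ be a semitopological semigroup (a semigroup with a topology for which all left and all right translations are continuous), and let $C(S)$ be the $C^*$-algebra of bounded continuous functions $S\to\mathbb C$ with the sup norm. For $f\in C(S)$ and $s\in S$ put $(L_sf)(t)=f(st)$. Let $$LMC(S)=\{f\in C(S): s\mapsto\mu(L_sf)\text{ is continuous on } S \text{ for every } \mu \text{ in the spectrum of } C(S)\},$$ a left translation invariant unital $*$-subalgebra of $C(S)$, and let $S^{LMC}$ be its spectrum, that is, the set of nonzero continuous multiplicative linear functionals on $LMC(S)$. For $\mu\in S^{LMC}$ and $f\in LMC(S)$ put $(T_\mu f)(s)=\mu(L_sf)$, and let $\Sigma=\{T_\mu:\mu\in S^{LMC}\}$. Let $F_0$ be the set of all constant functions on $S$ of modulus $1$ and, for $k\ge 1$, $$F_k=\{f\in LMC(S): |f|=1 \text{ and for every } \sigma\in\Sigma \text{ there is } f_\sigma\in F_{k-1} \text{ with } \sigma(f)=f_\sigma f\}.$$ For $k\ge1$, let $W_k(S)$ be the norm closure in $C(S)$ of the algebra generated by $F_k$, and let $W(S)$ be the norm closure in $C(S)$ of the algebra generated by $\bigcup_{k\ge1}F_k$. Corollary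 3.8. For every compact abelian topological group $G$ and every integer $k\ge1$, $W_k(G)=W(G)=C(G)$. -/

import Mathlib

open scoped BoundedContinuousFunction

namespace WeylAlgebra

noncomputable section

/-! Throughout, `S` is a semitopological semigroup (multiplication is separately continuous), and
`C(S)` is the C⋆-algebra `S →ᵇ ℂ` of bounded continuous complex functions with the sup norm. -/

/-- The left translation `L_s f = f ∘ l_s`, that is `(L_s f)(t) = f (s * t)`, on `C(S)`. -/
def leftTranslate {S : Type*} [Semigroup S] [TopologicalSpace S] [SeparatelyContinuousMul S]
    (s : S) (f : S →ᵇ ℂ) : S →ᵇ ℂ :=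
  f.compContinuous ⟨fun t => s * t, continuous_const_mul s⟩

theorem leftTranslate_leftTranslate {S : Type*} [Semigroup S] [TopologicalSpace S]
    [SeparatelyContinuousMul S] (s t : S) (f : S →ᵇ ℂ) :
    leftTranslate s (leftTranslate t f) = leftTranslate (t * s) f := by
  ext x
  exact congrArg f (mul_assoc t s x).symm

/-- The left multiplicatively continuous functions `LMC(S)`: those `f ∈ C(S)` for which
`s ↦ μ (L_s f)` is continuous for every `μ` in the spectrum (the Gelfand space) of `C(S)`. -/
def LMC (S : Type*) [Semigroup S] [TopologicalSpace S] [SeparatelyContinuousMul S] :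
    StarSubalgebra ℂ (S →ᵇ ℂ) where
  carrier := {f | ∀ μ : WeakDual.characterSpace ℂ (S →ᵇ ℂ),
    Continuous fun s : S => μ (leftTranslate s f)}
  mul_mem' {f g} hf hg μ := by
    have h : ∀ s, μ (leftTranslate s (f * g)) = μ (leftTranslate s f) * μ (leftTranslate s g) :=
      fun s => map_mul μ (leftTranslate s f) (leftTranslate s g)
    simp only [h]
    exact (hf μ).mul (hg μ)
  add_mem' {f g} hf hg μ := by
    have h : ∀ s, μ (leftTranslate s (f + g)) = μ (leftTranslate s f) + μ (leftTranslate s g) :=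
      fun s => map_add μ (leftTranslate s f) (leftTranslate s g)
    simp only [h]
    exact (hf μ).add (hg μ)
  algebraMap_mem' c μ := by
    have h : ∀ s : S, μ (leftTranslate s (algebraMap ℂ (S →ᵇ ℂ) c)) =
      μ (algebraMap ℂ (S →ᵇ ℂ) c) := fun s => rfl
    simpa only [h] using continuous_const
  star_mem' {f} hf μ := by
    have h : ∀ s, μ (leftTranslate s (star f)) = star (μ (leftTranslate s f)) :=
      fun s => map_star μ (leftTranslate s f)
    simpa only [h] using (hf μ).star

theorem leftTranslate_mem_LMC {S : Type*} [Semigroup S] [TopologicalSpace S]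
    [SeparatelyContinuousMul S] (s : S) {f : S →ᵇ ℂ} (hf : f ∈ LMC S) :
    leftTranslate s f ∈ LMC S := by
  intro μ
  simp only [leftTranslate_leftTranslate]
  exact (hf μ).comp (continuous_const_mul s)

/-- The function `T_μ f : s ↦ μ (L_s f)` for `f ∈ LMC(S)` and `μ` in the spectrum `S^LMC` of
`LMC(S)`. The set `Σ` consists of the operators `T_μ`, `μ ∈ S^LMC`. -/
def T {S : Type*} [Semigroup S] [TopologicalSpace S] [SeparatelyContinuousMul S]
    (μ : WeakDual.characterSpace ℂ (LMC S)) (f : LMC S) : S → ℂ :=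
  fun s => μ ⟨leftTranslate s f, leftTranslate_mem_LMC s f.2⟩

/-- The sets `F_k`: `F_0` consists of the constant functions of modulus `1`, and `F_{k+1}` of the
`f ∈ LMC(S)` with `|f| = 1` such that for every `σ ∈ Σ` one has `σ(f) = f_σ f` for some
`f_σ ∈ F_k`. -/
def F (S : Type*) [Semigroup S] [TopologicalSpace S] [SeparatelyContinuousMul S] :
    ℕ → Set (S →ᵇ ℂ)
  | 0 => {f | ∃ c : ℂ, ‖c‖ = 1 ∧ f = BoundedContinuousFunction.const S c}
  | k + 1 => {f | ∃ hf : f ∈ LMC S, (∀ s, ‖f s‖ = 1) ∧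
      ∀ μ : WeakDual.characterSpace ℂ (LMC S), ∃ g ∈ F S k, ∀ s, T μ ⟨f, hf⟩ s = g s * f s}

/-- `W_k(S)`: the norm closure in `C(S)` of the algebra generated by `F_k`
(which contains the constant function `1`). -/
def Wk (S : Type*) [Semigroup S] [TopologicalSpace S] [SeparatelyContinuousMul S] (k : ℕ) :
    Subalgebra ℂ (S →ᵇ ℂ) :=
  (Algebra.adjoin ℂ (F S k)).topologicalClosure

/-- `W(S)`: the norm closure in `C(S)` of the algebra generated by the union of the `F_k`,
`k ≥ 1`. -/
def W (S : Type*) [Semigroup S] [TopologicalSpace S] [SeparatelyContinuousMul S] :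
    Subalgebra ℂ (S →ᵇ ℂ) :=
  (Algebra.adjoin ℂ {f | ∃ k : ℕ, 1 ≤ k ∧ f ∈ F S k}).topologicalClosure

end

end WeylAlgebra

/-! A continuous character `χ` of `G` satisfies `L_s χ = χ(s) χ`, so every `T_μ` multiplies it by a
constant of modulus 1 and `χ` lies in all `F_k`, `k ≥ 1` (`mem_F_succ_of_map_mul`). By
Stone–Weierstrass it remains to separate points by characters, after passing to the Hausdorff
quotient (`Wk_eq_top`).

Separation (`exists_continuous_monoidHom_ne_one`) comes from Gelfand theory. Convolution operators
`C_u` on `C(G)` commute; for `u ≠ 0`, L² symmetry keeps `C_{u*} C_u` from being quasinilpotent, so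
some character `φ` of the Banach algebra they generate has `φ(C_u) ≠ 0`. With `f_x` the translate of
`f` and `u = f_g - f ≠ 0`, the quotient `φ(C_{f_x}) / φ(C_f)` is a character in `x` that is not 1 at
`g`. -/

open scoped InnerProductSpace
open MeasureTheory

/-! ### Lower bounds on powers, and the spectral radius -/

/-- The powers of a nonzero symmetric operator decay at most geometrically. -/
theorem exists_mul_pow_le_norm_pow_of_symmetric {E H : Type*} [NormedAddCommGroup E]
    [NormedSpace ℂ E] [NormedAddCommGroup H] [InnerProductSpace ℂ H] (J : E →L[ℂ] H)
    (T : E →L[ℂ] E) (hT : ∀ u v, ⟪J (T u), J v⟫_ℂ = ⟪J u, J (T v)⟫_ℂ) (h : E)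
    (hne : J (T h) ≠ 0) :
    ∃ b > 0, ∃ c > 0, ∀ n : ℕ, b * c ^ n ≤ ‖T ^ n‖ := by
  set B : ℕ → ℝ := fun n => ‖J ((T ^ n) h)‖ with hB
  have hsucc : ∀ n, (T ^ (n + 1)) h = T ((T ^ n) h) := fun n => by
    rw [pow_succ', mul_apply_eq_comp]
  -- Symmetry and Cauchy–Schwarz make `B` log-convex, so its successive ratios never fall below the
  -- first one, `c`.
  have hlog : ∀ n, B (n + 1) * B (n + 1) ≤ B n * B (n + 2) := by
    intro n
    have h1 : ⟪J ((T ^ (n + 1)) h), J ((T ^ (n + 1)) h)⟫_ℂ =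
        ⟪J ((T ^ n) h), J ((T ^ (n + 2)) h)⟫_ℂ := by
      rw [hsucc (n + 1), ← hT, hsucc n]
    have h2 := norm_inner_le_norm (𝕜 := ℂ) (J ((T ^ n) h)) (J ((T ^ (n + 2)) h))
    rwa [← h1, inner_self_eq_norm_sq_to_K, norm_pow, RCLike.norm_ofReal, abs_norm, sq] at h2
  have hpos1 : 0 < B 1 := by simpa [hB] using hne
  have hnn : ∀ n, 0 ≤ B n := fun n => norm_nonneg _
  have hpos0 : 0 < B 0 := by
    refine (hnn 0).lt_of_ne fun h0 => ?_
    have := hlog 0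
    rw [← h0] at this
    nlinarith
  set c := B 1 / B 0 with hc
  have hcpos : 0 < c := div_pos hpos1 hpos0
  have hstep : ∀ n, 0 < B n ∧ c * B n ≤ B (n + 1) := by
    intro n
    induction n with
    | zero => exact ⟨hpos0, by rw [hc, div_mul_cancel₀ _ hpos0.ne']⟩
    | succ n ih =>
      obtain ⟨ih1, ih2⟩ := ih
      have hp : 0 < B (n + 1) := lt_of_lt_of_le (mul_pos hcpos ih1) ih2
      refine ⟨hp, ?_⟩
      refine le_of_mul_le_mul_left ?_ ih1
      calc B n * (c * B (n + 1)) = (c * B n) * B (n + 1) := by ring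
        _ ≤ B (n + 1) * B (n + 1) := by gcongr
        _ ≤ B n * B (n + 1 + 1) := hlog n
  have hgeom : ∀ n, B 0 * c ^ n ≤ B n := by
    intro n
    induction n with
    | zero => simp
    | succ n ih =>
      calc B 0 * c ^ (n + 1) = c * (B 0 * c ^ n) := by ring
        _ ≤ c * B n := by gcongr
        _ ≤ B (n + 1) := (hstep n).2
  refine ⟨B 0 / (‖J‖ * ‖h‖ + 1), by positivity, c, hcpos, fun n => ?_⟩
  rw [div_mul_eq_mul_div, div_le_iff₀ (by positivity)]
  have h3 : B n ≤ ‖J‖ * (‖T ^ n‖ * ‖h‖) :=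
    (J.le_opNorm _).trans (by gcongr; exact (T ^ n).le_opNorm h)
  nlinarith [hgeom n, norm_nonneg (T ^ n)]

/-- In a commutative complex Banach algebra, an element whose powers do not decay faster than
geometrically is not annihilated by every character. -/
theorem exists_characterSpace_apply_ne_zero {A : Type*} [NormedCommRing A] [NormedAlgebra ℂ A]
    [CompleteSpace A] (a : A) {b c : ℝ} (hb : 0 < b) (hc : 0 < c)
    (h : ∀ n : ℕ, b * c ^ n ≤ ‖a ^ n‖) : ∃ φ : WeakDual.characterSpace ℂ A, φ a ≠ 0 := by
  by_contra! H
  have hr : spectralRadius ℂ a = 0 := by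
    refine le_antisymm (iSup₂_le fun z hz => ?_) bot_le
    obtain ⟨φ, hφ⟩ := WeakDual.CharacterSpace.mem_spectrum_iff_exists.1 hz
    simp [← hφ, H φ]
  -- By Gelfand's formula `‖a ^ n‖ < (c / 2) ^ n` eventually, which is absurd once `(1 / 2) ^ n <
  -- b`.
  have ht := spectrum.pow_norm_pow_one_div_tendsto_nhds_spectralRadius a
  rw [hr] at ht
  have h1 := ht.eventually (gt_mem_nhds (ENNReal.ofReal_pos.2 (half_pos hc)))
  have h2 : Filter.Tendsto (fun n : ℕ => (1 / 2 : ℝ) ^ n) Filter.atTop (nhds 0) :=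
    tendsto_pow_atTop_nhds_zero_of_lt_one (by norm_num) (by norm_num)
  obtain ⟨n, hn1, hn2, hn3⟩ :=
    (h1.and ((h2.eventually (gt_mem_nhds hb)).and (Filter.eventually_ge_atTop 1))).exists
  rw [ENNReal.ofReal_lt_ofReal_iff (half_pos hc)] at hn1
  have hn0 : n ≠ 0 := by omega
  have h4 : ‖a ^ n‖ < (c / 2) ^ n := by
    have := pow_lt_pow_left₀ hn1 (by positivity) hn0
    rwa [one_div, Real.rpow_inv_natCast_pow (norm_nonneg _) hn0] at this
  have h5 : (c / 2) ^ n = (1 / 2) ^ n * c ^ n := by rw [← mul_pow]; ring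
  have h6 := h n
  have h7 : 0 < c ^ n := by positivity
  nlinarith

/-! ### Convolution operators on a compact abelian group -/

section Convolution

variable {G : Type*} [CommGroup G] [TopologicalSpace G] [IsTopologicalGroup G]

/-- The translate `y ↦ f (x * y)` of a continuous function on a group. -/
noncomputable def ContinuousMap.translate (x : G) (f : C(G, ℂ)) : C(G, ℂ) :=
  f.comp ⟨fun y => x * y, by fun_prop⟩

@[simp] theorem ContinuousMap.translate_apply (x : G) (f : C(G, ℂ)) (y : G) :
    f.translate x y = f (x * y) := rfl

theorem ContinuousMap.translate_translate (x y : G) (f : C(G, ℂ)) :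
    (f.translate y).translate x = f.translate (x * y) := by
  ext z
  simp [← mul_assoc, mul_comm x y]

theorem ContinuousMap.continuous_translate (f : C(G, ℂ)) :
    Continuous fun x : G => f.translate x :=
  (ContinuousMap.curry (⟨fun p : G × G => f (p.1 * p.2), by fun_prop⟩ : C(G × G, ℂ))).continuous

/-- The function `x ↦ conj (f x⁻¹)`. -/
noncomputable def ContinuousMap.conjInv (f : C(G, ℂ)) : C(G, ℂ) :=
  star (f.comp ⟨fun y => y⁻¹, by fun_prop⟩)

@[simp] theorem ContinuousMap.conjInv_apply (f : C(G, ℂ)) (x : G) :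
    f.conjInv x = star (f x⁻¹) := rfl

theorem ContinuousMap.conjInv_conjInv (f : C(G, ℂ)) : f.conjInv.conjInv = f := by
  ext x
  simp

theorem ContinuousMap.integrable_of_compactSpace {X : Type*} [TopologicalSpace X] [CompactSpace X]
    [MeasurableSpace X] [BorelSpace X] (μ : Measure X) [IsFiniteMeasure μ] (f : C(X, ℂ)) :
    Integrable f μ :=
  Integrable.of_bound f.continuous.aestronglyMeasurable ‖f‖
    (Filter.Eventually.of_forall f.norm_coe_le_norm)

/-- Integration of continuous functions on a compact space. -/
noncomputable def ContinuousMap.integralCLM {X : Type*} [TopologicalSpace X] [CompactSpace X]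
    [MeasurableSpace X] [BorelSpace X] (μ : Measure X) [IsFiniteMeasure μ] : C(X, ℂ) →L[ℂ] ℂ :=
  LinearMap.mkContinuous
    { toFun := fun f => ∫ x, f x ∂μ
      map_add' := fun f g => integral_add (f.integrable_of_compactSpace μ)
        (g.integrable_of_compactSpace μ)
      map_smul' := fun c f => integral_smul c f }
    (μ.real Set.univ) fun f => by
      rw [mul_comm]
      exact norm_integral_le_of_norm_le_const (Filter.Eventually.of_forall f.norm_coe_le_norm)

/-- Compact support replaces measurability for the product σ-algebra, which may be too small when
`X` is not second countable. -/
theorem integral_integral_swap_of_continuous {X : Type*} [TopologicalSpace X]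
    [CompactSpace X] [MeasurableSpace X] [BorelSpace X] (μ : Measure X) [IsFiniteMeasure μ]
    {f : X → X → ℂ} (hf : Continuous f.uncurry) :
    ∫ x, (∫ y, f x y ∂μ) ∂μ = ∫ y, (∫ x, f x y ∂μ) ∂μ :=
  integral_integral_swap_of_hasCompactSupport hf (HasCompactSupport.of_compactSpace _)

/-- The kernel `(x, y) ↦ f (x * y⁻¹) * h y` of a convolution. -/
noncomputable def convolutionKernel (f h : C(G, ℂ)) : C(G, C(G, ℂ)) :=
  ContinuousMap.curry ⟨fun p : G × G => f (p.1 * p.2⁻¹) * h p.2, by fun_prop⟩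

@[simp] theorem convolutionKernel_apply (f h : C(G, ℂ)) (x y : G) :
    convolutionKernel f h x y = f (x * y⁻¹) * h y := rfl

variable [CompactSpace G] [MeasurableSpace G] [BorelSpace G] (μ : Measure G)
  [IsFiniteMeasure μ]

/-- Convolution as a continuous bilinear map on the continuous functions on a compact group. -/
noncomputable def convolutionCLM : C(G, ℂ) →L[ℂ] C(G, ℂ) →L[ℂ] C(G, ℂ) :=
  LinearMap.mkContinuous₂
    (LinearMap.mk₂ ℂ
      (fun f h => (⟨ContinuousMap.integralCLM μ, (ContinuousMap.integralCLM μ).continuous⟩ :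
        C(C(G, ℂ), ℂ)).comp (convolutionKernel f h))
      (fun f₁ f₂ h => by
        ext x
        change ContinuousMap.integralCLM μ _ = ContinuousMap.integralCLM μ _ +
          ContinuousMap.integralCLM μ _
        rw [← map_add]
        congr 1
        ext y
        simp [add_mul])
      (fun c f h => by
        ext x
        change ContinuousMap.integralCLM μ _ = c • ContinuousMap.integralCLM μ _
        rw [← map_smul]
        congr 1
        ext y
        simp [mul_assoc])
      (fun f h₁ h₂ => by
        ext x
        change ContinuousMap.integralCLM μ _ = ContinuousMap.integralCLM μ _ +
          ContinuousMap.integralCLM μ _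
        rw [← map_add]
        congr 1
        ext y
        simp [mul_add])
      (fun c f h => by
        ext x
        change ContinuousMap.integralCLM μ _ = c • ContinuousMap.integralCLM μ _
        rw [← map_smul]
        congr 1
        ext y
        simp [mul_left_comm]))
    (μ.real Set.univ) fun f h => by
      refine (ContinuousMap.norm_le _ (by positivity)).2 fun x => ?_
      rw [mul_assoc, mul_comm]
      refine norm_integral_le_of_norm_le_const (Filter.Eventually.of_forall fun y => ?_)
      rw [convolutionKernel_apply, norm_mul]
      gcongr <;> exact ContinuousMap.norm_coe_le_norm _ _

theorem convolutionCLM_apply (f h : C(G, ℂ)) (x : G) :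
    convolutionCLM μ f h x = ∫ y, f (x * y⁻¹) * h y ∂μ := rfl

theorem convolutionCLM_translate_left (x : G) (f h : C(G, ℂ)) :
    convolutionCLM μ (f.translate x) h = (convolutionCLM μ f h).translate x := by
  ext z
  simp [convolutionCLM_apply, mul_assoc]

theorem inner_toLp_convolutionCLM_left (f u v : C(G, ℂ)) :
    ⟪ContinuousMap.toLp 2 μ ℂ (convolutionCLM μ f u), ContinuousMap.toLp 2 μ ℂ v⟫_ℂ =
      ⟪ContinuousMap.toLp 2 μ ℂ u, ContinuousMap.toLp 2 μ ℂ (convolutionCLM μ f.conjInv v)⟫_ℂ := by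
  rw [ContinuousMap.inner_toLp, ContinuousMap.inner_toLp]
  simp only [convolutionCLM_apply, ← integral_conj, ← integral_const_mul, ← integral_mul_const]
  rw [integral_integral_swap_of_continuous]
  · refine integral_congr_ae (Filter.Eventually.of_forall fun y => ?_)
    refine integral_congr_ae (Filter.Eventually.of_forall fun x => ?_)
    simp
    ring
  · simp only [Function.uncurry_def]
    fun_prop

/-- The operator is symmetric for the L² inner product. It does not kill `f.conjInv`: otherwise `f *
f.conjInv` would vanish, yet its value at 1 is the squared L² norm of `f.conjInv`. -/
theorem exists_norm_pow_convolutionCLM [μ.IsOpenPosMeasure] {f : C(G, ℂ)} (hf : f ≠ 0) :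
    ∃ b > 0, ∃ c > 0, ∀ n : ℕ,
      b * c ^ n ≤ ‖(convolutionCLM μ f.conjInv * convolutionCLM μ f) ^ n‖ := by
  have hinj : ∀ u : C(G, ℂ), ContinuousMap.toLp 2 μ ℂ u = 0 → u = 0 := fun u hu =>
    ContinuousMap.toLp_injective μ (hu.trans (map_zero _).symm)
  refine exists_mul_pow_le_norm_pow_of_symmetric (ContinuousMap.toLp 2 μ ℂ) _ (fun u v => ?_)
    f.conjInv fun h => ?_
  · simp only [mul_apply_eq_comp]
    rw [inner_toLp_convolutionCLM_left, f.conjInv_conjInv, inner_toLp_convolutionCLM_left]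
  · have h1 : convolutionCLM μ f f.conjInv = 0 := by
      apply hinj
      rw [← inner_self_eq_zero (𝕜 := ℂ), inner_toLp_convolutionCLM_left]
      rw [mul_apply_eq_comp] at h
      rw [h, inner_zero_right]
    have h2 : ⟪ContinuousMap.toLp 2 μ ℂ f.conjInv, ContinuousMap.toLp 2 μ ℂ f.conjInv⟫_ℂ = 0 := by
      rw [ContinuousMap.inner_toLp]
      have h3 := DFunLike.congr_fun h1 1
      rw [convolutionCLM_apply] at h3
      simpa [mul_comm] using h3
    have h4 := hinj _ (inner_self_eq_zero.1 h2)
    apply hf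
    rw [← f.conjInv_conjInv, h4]
    ext
    simp

variable [μ.IsMulLeftInvariant]

theorem convolutionCLM_translate_right (x : G) (f h : C(G, ℂ)) :
    convolutionCLM μ f (h.translate x) = (convolutionCLM μ f h).translate x := by
  ext z
  simp only [convolutionCLM_apply, ContinuousMap.translate_apply]
  rw [← integral_mul_left_eq_self (fun y => f (x * z * y⁻¹) * h y) x]
  refine integral_congr_ae (Filter.Eventually.of_forall fun y => ?_)
  have : x * z * (x * y)⁻¹ = z * y⁻¹ := by rw [mul_inv, mul_mul_mul_comm]; simp
  simp only [this]

/-- Translations pull out of either argument, so both sides are `C_f C_f` followed by translation by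
`x * y`. -/
theorem convolutionCLM_translate_mul (x y : G) (f : C(G, ℂ)) :
    convolutionCLM μ (f.translate x) * convolutionCLM μ (f.translate y) =
      convolutionCLM μ (f.translate (x * y)) * convolutionCLM μ f := by
  ext1 h
  simp only [mul_apply_eq_comp, convolutionCLM_translate_left,
    convolutionCLM_translate_right, ContinuousMap.translate_translate, mul_comm y x]

variable [μ.IsInvInvariant]

theorem convolutionCLM_comm (f g : C(G, ℂ)) :
    convolutionCLM μ f * convolutionCLM μ g = convolutionCLM μ g * convolutionCLM μ f := by
  ext h z
  simp only [mul_apply_eq_comp, convolutionCLM_apply, ← integral_const_mul]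
  have hc : ∀ f g : C(G, ℂ),
      Continuous (Function.uncurry fun y w : G => f (z * y⁻¹) * (g (y * w⁻¹) * h w)) := by
    intro f g
    simp only [Function.uncurry_def]
    fun_prop
  rw [integral_integral_swap_of_continuous μ (hc f g),
    integral_integral_swap_of_continuous μ (hc g f)]
  · refine integral_congr_ae (Filter.Eventually.of_forall fun w => ?_)
    dsimp only
    -- The substitution `y ↦ z * w * y⁻¹` exchanges `z * y⁻¹` and `y * w⁻¹`.
    rw [← integral_inv_eq_self,
      ← integral_mul_left_eq_self (fun y => f (z * y⁻¹⁻¹) * (g (y⁻¹ * w⁻¹) * h w)) (z * w)⁻¹]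
    refine integral_congr_ae (Filter.Eventually.of_forall fun y => ?_)
    have h1 : z * ((z * w)⁻¹ * y)⁻¹⁻¹ = y * w⁻¹ := by
      rw [inv_inv, mul_inv, mul_comm (z⁻¹ * w⁻¹) y, mul_left_comm, mul_inv_cancel_left]
    have h2 : ((z * w)⁻¹ * y)⁻¹ * w⁻¹ = z * y⁻¹ := by simp [mul_comm, mul_left_comm]
    dsimp only
    rw [h1, h2]
    ring

end Convolution

/-! ### Characters separate points -/

/-- In the closed commutative subalgebra generated by commuting elements of a complex Banach
algebra, an element whose powers do not decay faster than geometrically is not annihilated by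
every character. -/
theorem exists_algHom_topologicalClosure_adjoin_apply_ne_zero {B : Type*} [NormedRing B]
    [NormedAlgebra ℂ B] [CompleteSpace B] {S : Set B} (hS : ∀ a ∈ S, ∀ b ∈ S, a * b = b * a)
    (a : (Algebra.adjoin ℂ S).topologicalClosure) {b c : ℝ} (hb : 0 < b) (hc : 0 < c)
    (h : ∀ n : ℕ, b * c ^ n ≤ ‖(a : B) ^ n‖) :
    ∃ φ : (Algebra.adjoin ℂ S).topologicalClosure →ₐ[ℂ] ℂ, Continuous φ ∧ φ a ≠ 0 := by
  have hcomm : ∀ x y : Algebra.adjoin ℂ S, x * y = y * x :=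
    (Algebra.isMulCommutative_adjoin ℂ hS).is_comm.comm
  let _ : NormedCommRing (Algebra.adjoin ℂ S).topologicalClosure :=
    { (inferInstance : NormedRing (Algebra.adjoin ℂ S).topologicalClosure) with
      mul_comm := (Subalgebra.commRingTopologicalClosure _ hcomm).mul_comm }
  have : CompleteSpace (Algebra.adjoin ℂ S).topologicalClosure :=
    (Subalgebra.isClosed_topologicalClosure _).completeSpace_coe
  obtain ⟨φ, hφ⟩ := exists_characterSpace_apply_ne_zero a hb hc h
  exact ⟨WeakDual.CharacterSpace.toAlgHom φ, map_continuous φ, hφ⟩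

theorem MonoidHom.norm_eq_one_of_continuous {G : Type*} [Group G] [TopologicalSpace G]
    [CompactSpace G] (χ : G →* ℂ) (hχ : Continuous χ) (x : G) : ‖χ x‖ = 1 := by
  have hle : ∀ y, ‖χ y‖ ≤ 1 := by
    intro y
    by_contra! hy
    obtain ⟨n, hn⟩ := pow_unbounded_of_one_lt ‖(⟨χ, hχ⟩ : C(G, ℂ))‖ hy
    rw [← norm_pow, ← map_pow] at hn
    exact hn.not_ge ((⟨χ, hχ⟩ : C(G, ℂ)).norm_coe_le_norm (y ^ n))
  refine le_antisymm (hle x) ?_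
  have h1 : ‖χ x‖ * ‖χ x⁻¹‖ = 1 := by rw [← norm_mul, ← map_mul]; simp
  nlinarith [hle x⁻¹, norm_nonneg (χ x)]

/-- The continuous characters of a compact Hausdorff abelian group separate its points. -/
theorem exists_continuous_monoidHom_ne_one {G : Type*} [CommGroup G] [TopologicalSpace G]
    [IsTopologicalGroup G] [CompactSpace G] [T2Space G] {g : G} (hg : g ≠ 1) :
    ∃ χ : G →* ℂ, Continuous χ ∧ χ g ≠ 1 := by
  let _ : MeasurableSpace G := borel G
  have : BorelSpace G := ⟨rfl⟩
  let μ : Measure G := Measure.haar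
  obtain ⟨f₀, hf0, hf1, -⟩ := exists_continuous_zero_one_of_isClosed
    (isClosed_singleton (x := g)) (isClosed_singleton (x := (1 : G)))
    (Set.disjoint_singleton.2 hg)
  let f : C(G, ℂ) := ⟨fun x => (f₀ x : ℂ), by fun_prop⟩
  let h : C(G, ℂ) := f.translate g - f
  have hh : h ≠ 0 := by
    intro H
    have := DFunLike.congr_fun H 1
    simp [h, f, hf0 (Set.mem_singleton g), hf1 (Set.mem_singleton (1 : G))] at this
  have hmem : ∀ u, convolutionCLM μ u ∈
      (Algebra.adjoin ℂ (Set.range (convolutionCLM μ))).topologicalClosure := fun u =>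
    Subalgebra.le_topologicalClosure _ (Algebra.subset_adjoin ⟨u, rfl⟩)
  obtain ⟨b, hb, c, hc, hbc⟩ := exists_norm_pow_convolutionCLM μ hh
  obtain ⟨φ, hφ, hφ0⟩ := exists_algHom_topologicalClosure_adjoin_apply_ne_zero
    (S := Set.range (convolutionCLM μ))
    (by rintro _ ⟨u, rfl⟩ _ ⟨v, rfl⟩; exact convolutionCLM_comm μ u v)
    (⟨_, hmem h.conjInv⟩ * ⟨_, hmem h⟩) hb hc hbc
  let ψ : C(G, ℂ) → ℂ := fun u => φ ⟨convolutionCLM μ u, hmem u⟩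
  have hψc : Continuous ψ := hφ.comp ((convolutionCLM μ).continuous.subtype_mk hmem)
  have hψmul : ∀ x y, ψ (f.translate x) * ψ (f.translate y) = ψ (f.translate (x * y)) * ψ f := by
    intro x y
    simp only [ψ, ← map_mul]
    exact congrArg φ (Subtype.ext (convolutionCLM_translate_mul μ x y f))
  have hψh : ψ h ≠ 0 := by
    rw [map_mul] at hφ0
    exact right_ne_zero_of_mul hφ0
  have hψsub : ψ h = ψ (f.translate g) - ψ f := by
    simp only [ψ, ← map_sub]
    exact congrArg φ (Subtype.ext (map_sub (convolutionCLM μ) _ _))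
  -- If `ψ f = 0`, then `hψmul g g` forces `ψ (f.translate g) = 0`, hence `ψ h = 0`.
  have hψf : ψ f ≠ 0 := by
    intro H
    have := hψmul g g
    rw [H, mul_zero, mul_self_eq_zero] at this
    exact hψh (by rw [hψsub, this, H, sub_zero])
  have h1 : f.translate 1 = f := by ext; simp
  refine ⟨{ toFun := fun x => ψ (f.translate x) / ψ f
            map_one' := by rw [h1, div_self hψf]
            map_mul' := fun x y => ?_ },
    (hψc.comp f.continuous_translate).div_const _, fun H => ?_⟩
  · rw [div_mul_div_comm, hψmul, mul_div_mul_right _ _ hψf]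
  · apply hψh
    rw [hψsub, sub_eq_zero]
    exact (div_eq_one_iff_eq hψf).1 H

/-! ### Characters in `F_k` and density -/

namespace WeylAlgebra

theorem const_mem_F {S : Type*} [Semigroup S] [TopologicalSpace S] [SeparatelyContinuousMul S]
    (k : ℕ) {c : ℂ} (hc : ‖c‖ = 1) : BoundedContinuousFunction.const S c ∈ F S k := by
  induction k generalizing c with
  | zero => exact ⟨c, hc, rfl⟩
  | succ k ih =>
    refine ⟨(LMC S).algebraMap_mem c, fun _ => hc, fun μ =>
      ⟨BoundedContinuousFunction.const S 1, ih norm_one, fun s => ?_⟩⟩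
    have h : T μ ⟨BoundedContinuousFunction.const S c, (LMC S).algebraMap_mem c⟩ s =
      μ (algebraMap ℂ (LMC S) c) := rfl
    rw [h, AlgHomClass.commutes]
    simp

/-- A character of a (possibly incomplete) normed algebra is bounded by one on the unit ball. -/
theorem norm_characterSpace_apply_le_one {A : Type*} [NormedRing A] [NormedAlgebra ℂ A]
    (μ : WeakDual.characterSpace ℂ A) {a : A} (ha : ‖a‖ ≤ 1) : ‖μ a‖ ≤ 1 := by
  by_contra! h
  -- All powers of `μ a` are values of `μ` on the unit ball; the exponent `n + 1` avoids `‖1‖`,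
  -- which need not be 1.
  obtain ⟨n, hn⟩ := pow_unbounded_of_one_lt ‖WeakDual.CharacterSpace.toCLM μ‖ h
  have h1 : ‖μ a‖ ^ n ≤ ‖μ a‖ ^ (n + 1) := pow_le_pow_right₀ h.le n.le_succ
  have h2 : ‖μ (a ^ (n + 1))‖ ≤ ‖WeakDual.CharacterSpace.toCLM μ‖ * ‖a ^ (n + 1)‖ :=
    (WeakDual.CharacterSpace.toCLM μ).le_opNorm _
  have h3 : ‖a ^ (n + 1)‖ ≤ 1 :=
    (norm_pow_le' a n.succ_pos).trans (pow_le_one₀ (norm_nonneg a) ha)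
  rw [map_pow, norm_pow] at h2
  nlinarith [norm_nonneg (WeakDual.CharacterSpace.toCLM μ)]

theorem mem_F_succ_of_map_mul {S : Type*} [Semigroup S] [TopologicalSpace S]
    [SeparatelyContinuousMul S] (k : ℕ) {f : S →ᵇ ℂ} (hmul : ∀ x y, f (x * y) = f x * f y)
    (hf : ∀ x, ‖f x‖ = 1) : f ∈ F S (k + 1) := by
  have htr : ∀ s, leftTranslate s f = f s • f := fun s => by
    ext t
    exact hmul s t
  have hmem : f ∈ LMC S := by
    intro μ
    simp only [htr, map_smul]
    fun_prop
  refine ⟨hmem, hf, fun μ => ⟨BoundedContinuousFunction.const S (μ ⟨f, hmem⟩),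
    const_mem_F k ?_, fun s => ?_⟩⟩
  · have hnorm : ∀ g : LMC S, (∀ x, ‖(g : S →ᵇ ℂ) x‖ = 1) → ‖μ g‖ ≤ 1 := fun g hg =>
      norm_characterSpace_apply_le_one μ
        ((BoundedContinuousFunction.norm_le zero_le_one).2 fun x => (hg x).le)
    -- `f` is unitary and `μ` is at most 1 in modulus on both `f` and `star f`, so `‖μ f‖ = 1`.
    have h1 : star (⟨f, hmem⟩ : LMC S) * ⟨f, hmem⟩ = 1 := by
      ext x
      change (starRingEnd ℂ) (f x) * f x = 1
      rw [Complex.conj_mul', hf]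
      simp
    have h2 := congrArg (fun a => ‖μ a‖) h1
    simp only [map_mul, map_one, norm_mul, norm_one] at h2
    have h3 := hnorm (star ⟨f, hmem⟩) fun x => (norm_star (f x)).trans (hf x)
    refine le_antisymm (hnorm _ hf) ?_
    nlinarith [norm_nonneg (μ ⟨f, hmem⟩)]
  · have h : T μ ⟨f, hmem⟩ s = μ (f s • (⟨f, hmem⟩ : LMC S)) :=
      congrArg μ (Subtype.ext (htr s))
    rw [h, map_smul, smul_eq_mul, mul_comm]
    rfl

instance compactSpace_separationQuotient (G : Type*) [TopologicalSpace G] [CompactSpace G] :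
    CompactSpace (SeparationQuotient G) :=
  SeparationQuotient.surjective_mk.compactSpace SeparationQuotient.continuous_mk

/-- Pullback of continuous functions along the projection to the Hausdorff quotient. -/
noncomputable def separationQuotientPullback (G : Type*) [TopologicalSpace G] [CompactSpace G] :
    C(SeparationQuotient G, ℂ) →ₐ[ℂ] (G →ᵇ ℂ) where
  toFun f := (BoundedContinuousFunction.mkOfCompact f).compContinuous
    ⟨SeparationQuotient.mk, SeparationQuotient.continuous_mk⟩
  map_one' := rfl
  map_mul' _ _ := rfl
  map_zero' := rfl
  map_add' _ _ := rfl
  commutes' _ := rfl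

theorem continuous_separationQuotientPullback (G : Type*) [TopologicalSpace G] [CompactSpace G] :
    Continuous (separationQuotientPullback G) :=
  (BoundedContinuousFunction.continuous_compContinuous _).comp
    (ContinuousMap.isometryEquivBoundedOfCompact (SeparationQuotient G) ℂ).continuous

/-- A continuous function into a Hausdorff space cannot distinguish inseparable points. -/
theorem separationQuotientPullback_surjective (G : Type*) [TopologicalSpace G] [CompactSpace G]
    [R1Space G] : Function.Surjective (separationQuotientPullback G) := fun f =>
  ⟨⟨SeparationQuotient.lift f fun _ _ h => (h.map f.continuous).eq,
    SeparationQuotient.continuous_lift f.continuous⟩, by ext x; rfl⟩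

theorem Wk_eq_top (G : Type*) [CommGroup G] [TopologicalSpace G] [IsTopologicalGroup G]
    [CompactSpace G] (k : ℕ) : Wk G (k + 1) = ⊤ := by
  let X : Set C(SeparationQuotient G, ℂ) :=
    {f | (∀ x y, f (x * y) = f x * f y) ∧ ∀ x, ‖f x‖ = 1}
  -- `Wk` is generated without conjugation; as `X` is self-conjugate, its star algebra still lands
  -- there.
  have hstar : star X ⊆ X := by
    intro f hf
    have hf' : star f ∈ X := hf
    have h : ∀ x, f x = star ((star f) x) := fun x => by simp
    refine ⟨fun x y => ?_, fun x => ?_⟩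
    · rw [h, hf'.1, star_mul', ← h, ← h]
    · rw [h, norm_star, hf'.2]
  have hX : X ⊆ (Wk G (k + 1)).comap (separationQuotientPullback G) := fun f hf =>
    Subalgebra.le_topologicalClosure _ (Algebra.subset_adjoin
      (mem_F_succ_of_map_mul k (fun x y => hf.1 (.mk x) (.mk y)) fun x => hf.2 (SeparationQuotient.mk x)))
  have hclosed : IsClosed
      ((Wk G (k + 1)).comap (separationQuotientPullback G) : Set C(SeparationQuotient G, ℂ)) :=
    (Subalgebra.isClosed_topologicalClosure _).preimage (continuous_separationQuotientPullback G)
  have hsep : (StarAlgebra.adjoin ℂ X).SeparatesPoints := by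
    intro x y hxy
    obtain ⟨χ, hχ, hne⟩ := exists_continuous_monoidHom_ne_one
      (fun h => hxy (inv_mul_eq_one.1 h) : x⁻¹ * y ≠ 1)
    refine ⟨χ, ⟨⟨χ, hχ⟩, StarAlgebra.subset_adjoin ℂ X
      ⟨map_mul χ, χ.norm_eq_one_of_continuous hχ⟩, rfl⟩, fun h => hne ?_⟩
    rw [map_mul, ← h, ← map_mul, inv_mul_cancel, map_one]
  have hdense := ContinuousMap.starSubalgebra_topologicalClosure_eq_top_of_separatesPoints _ hsep
  have hle : ((StarAlgebra.adjoin ℂ X : StarSubalgebra ℂ C(SeparationQuotient G, ℂ)) :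
      Set C(SeparationQuotient G, ℂ)) ⊆
      (Wk G (k + 1)).comap (separationQuotientPullback G) := by
    intro f hf
    have hf' : f ∈ Algebra.adjoin ℂ (X ∪ star X) := hf
    exact Algebra.adjoin_le (Set.union_subset hX (hstar.trans hX)) hf'
  refine eq_top_iff.2 fun f _ => ?_
  obtain ⟨u, rfl⟩ := separationQuotientPullback_surjective G f
  have hu : u ∈ (StarAlgebra.adjoin ℂ X).topologicalClosure := hdense ▸ StarSubalgebra.mem_top
  exact closure_minimal hle hclosed hu

theorem Wk_le_W (S : Type*) [Semigroup S] [TopologicalSpace S] [SeparatelyContinuousMul S]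
    {k : ℕ} (hk : 1 ≤ k) : Wk S k ≤ W S :=
  Subalgebra.topologicalClosure_mono (Algebra.adjoin_mono fun _ hf => ⟨k, hk, hf⟩)

end WeylAlgebra

theorem corollary3p8 (G : Type*) [CommGroup G] [TopologicalSpace G] [IsTopologicalGroup G]
    [CompactSpace G] (k : ℕ) (hk : 1 ≤ k) :
    WeylAlgebra.Wk G k = WeylAlgebra.W G ∧ WeylAlgebra.W G = ⊤ := by
  obtain ⟨k, rfl⟩ := Nat.exists_eq_add_of_le' hk
  have h := WeylAlgebra.Wk_eq_top G k
  have hW : WeylAlgebra.W G = ⊤ := top_le_iff.1 (h ▸ WeylAlgebra.Wk_le_W G hk)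
  exact ⟨h.trans hW.symm, hW⟩
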